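/- For a simplicial set $X$, let $\operatorname{Ex}X$ be the simplicial set with $(\operatorname{Ex}X)_n=\operatorname{Hom}(\operatorname{Sd}\Delta[n],X)$, where $\operatorname{Sd}\Delta[n]=N\mathcal K([n])$ is the nerve of the poset of nonempty subsets of $[n]=\{0,\dots,n\}$ ordered by inclusion (functorial in $[n]$ through direct images). The map $\max:\mathcal K([n])\to[n]$ induces natural maps $\operatorname{Sd}\Delta[n]\to\Delta[n]$, and hence, by precomposition, a natural map $X\to\operatorname{Ex}X$. Cofibrations are the maps with the left lifting property against every map that has the right lifting property against all boundary inclusions $\partial\Delta[n]\hookrightarrow\Delta[n]$; $X$ is cofibrant if $\emptyset\to X$ is a cofibration. (Constructively this means that it is decidable whether a cell of $X$ is degenerate; in classical logic, in which this statement is formulated, all monomorphisms are cofibrations and every $X$ is cofibrant.) A $P$-structure on a cofibration $A\to B$, where $A$ is identified with its image in $B$, consists of a partition of the set of nondegenerate cells of $B$ that are not in $A$ into two sets $B_{\mathrm I}$ and $B_{\mathrm{II}}$, and of a bijection $P:B_{\mathrm{II}}\to B_{\mathrm I}$, such that for every $x\in B_{\mathrm{II}}$: (1) $\dim(Px)=\dim(x)+1$;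 (2) there is a unique $i$ with $d_i(Px)=x$; (3) $x$ has finite $P$-height, that is, $\mathrm{Ant}^k(x)=\emptyset$ for some $k\ge1$. Here the set $\mathrm{Ant}(b)$ of antecedents of a cell $b$ of $B$ is defined as follows. If $b\in B_{\mathrm{II}}$ and $d_i(Pb)=b$, it consists of the cells $d_j(Pb)$ with $j\ne i$ and of all their iterated faces; $\mathrm{Ant}(Pb)=\mathrm{Ant}(b)$ for $b\in B_{\mathrm{II}}$; $\mathrm{Ant}(b)=\emptyset$ if $b$ is in $A$; and if $b$ is degenerate and not in $A$, then $\mathrm{Ant}(b)=\mathrm{Ant}(b')$, where $b'$ is the unique nondegenerate cell of which $b$ is a degeneracy. Moreover $\mathrm{Ant}^1=\mathrm{Ant}$ and $\mathrm{Ant}^{k}(b)=\bigcup_{c\in\mathrm{Ant}(b)}\mathrm{Ant}^{k-1}(c)$ for $k\geq 2$. A map is strongly anodyne if it is a cofibration and admits a $P$-structure. **Proposition.** Let $f:X\to Y$ be a map of simplicial sets with $X$ cofibrant. Then the canonical map $$X\longrightarrow \operatorname{Ex}X\times_{\operatorname{Ex}Y}Y,$$ whose components are $X\to\operatorname{Ex}X$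 and $f$, is strongly anodyne. -/

import Mathlib

open CategoryTheory CategoryTheory.Limits Simplicial Opposite

universe u

namespace SSet

/-- The order-preserving function `max : K([n]) → [n]` sending a nonempty subset
of `[n]` to its greatest element. -/
def chainMax (n : SimplexCategory) :
    PartialOrder.NonemptyFiniteChains (ULift.{u} (Fin (n.len + 1))) →o Fin (n.len + 1) where
  toFun S := S.finset.sup' S.nonempty ULift.down
  monotone' _ _ h := Finset.sup'_mono _ h _

lemma chainMax_map {n m : SimplexCategory} (g : n ⟶ m)
    (S : PartialOrder.NonemptyFiniteChains (ULift.{u} (Fin (n.len + 1)))) :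
    chainMax m (S.map (SimplexCategory.toPartOrd.{u}.map g).hom) = g (chainMax n S) := by
  apply le_antisymm
  · refine Finset.sup'_le (S.map (SimplexCategory.toPartOrd.{u}.map g).hom).nonempty _
      fun y hy ↦ ?_
    obtain ⟨x, hx, rfl⟩ := (PartialOrder.NonemptyFiniteChains.mem_map_iff _ _ _).1 hy
    exact g.toOrderHom.monotone (Finset.le_sup' ULift.down hx)
  · obtain ⟨x, hx, hx'⟩ := Finset.exists_mem_eq_sup' S.nonempty ULift.down
    have h : chainMax n S = x.down := hx'
    rw [h]
    exact Finset.le_sup' (α := Fin (m.len + 1)) (f := ULift.down)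
      ((PartialOrder.NonemptyFiniteChains.mem_map_iff S
        (SimplexCategory.toPartOrd.{u}.map g).hom _).2 ⟨x, hx, rfl⟩)

/-- The natural map `Sd Δ[n] = N K([n]) ⟶ Δ[n]` induced by `max : K([n]) → [n]`. -/
noncomputable def sdMax : SimplexCategory.sd.{u} ⟶ stdSimplex.{u} where
  app n :=
    { app k := ↾fun s ↦ stdSimplex.objMk
        ((chainMax n).comp ⟨fun i ↦ s.obj i, fun _ _ h ↦ leOfHom (s.map (homOfLE h))⟩)
      naturality _ _ _ := rfl }
  naturality n m g := by
    ext k s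
    apply stdSimplex.objEquiv.injective
    ext i
    exact congrArg Fin.val (chainMax_map g (s.obj i))

/-- The natural transformation `X ⟶ Ex X`: an `n`-cell `x : Δ[n] ⟶ X` is sent to the
`n`-cell of `Ex X` given by the composite `Sd Δ[n] ⟶ Δ[n] ⟶ X`. -/
noncomputable def toEx : 𝟭 SSet.{u} ⟶ ex.{u} where
  app X :=
    { app n := ↾fun x ↦ ULift.up (sdMax.app n.unop ≫ uliftYonedaEquiv.symm x)
      naturality n m g := by
        ext x
        apply ULift.down_injective
        change sdMax.app m.unop ≫ uliftYonedaEquiv.symm (X.map g x) =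
          SimplexCategory.sd.map g.unop ≫ sdMax.app n.unop ≫ uliftYonedaEquiv.symm x
        rw [uliftYonedaEquiv_symm_map]
        exact (sdMax.naturality_assoc g.unop _).symm }
  naturality X Y f := by
    ext n x
    apply ULift.down_injective
    change sdMax.app n.unop ≫ uliftYonedaEquiv.symm (f.app n x) =
      (sdMax.app n.unop ≫ uliftYonedaEquiv.symm x) ≫ f
    exact (congrArg (sdMax.app n.unop ≫ ·) (uliftYonedaEquiv_symm_comp x f).symm).trans
      (Category.assoc _ _ _).symm

/-- The canonical map `X ⟶ Ex X ×_{Ex Y} Y` attached to `f : X ⟶ Y`. -/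
noncomputable def toExPullback {X Y : SSet.{u}} (f : X ⟶ Y) :
    X ⟶ pullback (ex.map f) (toEx.app Y) :=
  pullback.lift (toEx.app X) f (toEx.naturality f).symm

/-- Cofibrations: the left class of the weak factorization system cofibrantly generated by
the boundary inclusions `∂Δ[n] ⟶ Δ[n]`. -/
def isCofibration : MorphismProperty SSet.{u} := modelCategoryQuillen.I.rlp.llp

/-- `X` is cofibrant if the map from the empty simplicial set is a cofibration. -/
def IsCofibrantSSet (X : SSet.{u}) : Prop := isCofibration (initial.to X)

namespace Subcomplex.Pairing

variable {B : SSet.{u}} {A : B.Subcomplex} (P : A.Pairing) [P.IsProper]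

/-- For a type (II) cell `b`, with `i` the unique index such that `d_i (P b) = b`: the set
`Ant₀(b)` of the cells `d_j (P b)` with `j ≠ i`. -/
def ant₀ (b : P.II) : Set B.S :=
  {c | ∃ j : Fin (b.1.dim + 2), j ≠ (P.isUniquelyCodimOneFace b).index rfl ∧
    c = S.mk (B.δ j ((P.p b).1.cast (P.dim_p b)).simplex)}

/-- For a type (II) cell `b`: the cells in `Ant₀(b)` together with all their iterated faces. -/
def antII (b : P.II) : Set B.S :=
  {c | ∃ a ∈ P.ant₀ b, ∃ (m : ℕ) (g : ⦋m⦌ ⟶ ⦋a.dim⦌), Mono g ∧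
    c = S.mk (B.map g.op a.simplex)}

/-- The antecedents of an arbitrary cell `b` of `B`. Here `b.toN` is the unique nondegenerate
cell of which `b` is a degeneracy (`b` itself if `b` is nondegenerate). If it is a type (II)
cell `y`, or the type (I) cell `P y`, then `Ant(b) = Ant(y)`; if `b` is in `A`, so is `b.toN`,
and `Ant(b)` is empty. -/
def ant (b : B.S) : Set B.S :=
  {c | ∃ y : P.II, (b.toN = y.1.toN ∨ b.toN = (P.p y).1.toN) ∧ c ∈ P.antII y}

/-- Iterated antecedents: `P.antIter k` is `Ant^{k+1}`, where `Ant¹ = Ant` and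
`Ant^{k}(b) = ⋃_{c ∈ Ant(b)} Ant^{k-1}(c)`. -/
def antIter (k : ℕ) : B.S → Set B.S :=
  match k with
  | 0 => fun b ↦ P.ant b
  | k + 1 => fun b ↦ ⋃ c ∈ P.ant b, antIter k c

/-- The cell `b` has finite `P`-height: `Ant^k(b) = ∅` for some `k ≥ 1`. -/
def HasFiniteHeight (b : B.S) : Prop := ∃ k : ℕ, P.antIter k b = ∅

end Subcomplex.Pairing

/-- A `P`-structure on a map `f : A ⟶ B`: a partition of the set of nondegenerate cells
of `B` not in the image of `A` into type (I) and type (II) cells, with a bijection `P` from type (II)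
to type (I) cells (`pairing`), such that `dim (P x) = dim x + 1` and there is a unique `i`
with `d_i (P x) = x` (`isProper`), and such that all type (II) cells have finite `P`-height. -/
structure PStructure {A B : SSet.{u}} (f : A ⟶ B) where
  pairing : (Subcomplex.range f).Pairing
  isProper : pairing.IsProper
  finiteHeight (b : pairing.II) : pairing.HasFiniteHeight b.1.toS

/-- A map is strongly anodyne if it is a cofibration which admits a `P`-structure. -/
def IsStronglyAnodyne {A B : SSet.{u}} (f : A ⟶ B) : Prop :=
  isCofibration f ∧ Nonempty (PStructure f)

end SSet

/-! The section `a ↦ {0, …, a}` of `max` makes `Δ[n]` a retract of `Sd Δ[n]`. Hence `X ⟶ Ex X` is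
injective, so the canonical map is a monomorphism, and `Z = Ex X ×_{Ex Y} Y` embeds in `Ex X`. The
poset maps `truncMap θ k` lie over `θ` with respect to `max`, so they act on the cells of `Z`.

For `θ = 𝟙` they give nested idempotents `trunc k`, trivial on `n`-cells for `k > n` and with image
`X` for `k = 1`. A cell outside `X` thus has a level `i ≥ 1`. If `z` has level `i`, then `cone i z`
is one dimension higher, has the same level, and its face `i + 1` is `z` (`δ_cone`). A nondegenerate
cell outside `X` has type (I) if it is a cone at its own level and type (II) otherwise, with `P z =
cone i z`. This is a bijection because cones of cones or of degenerate cells are degenerate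
(`cone_cone`, `cone_mem_degenerate`), while all other cones of cells at their level are
nondegenerate (`cone_mem_nonDegenerate`).

Heights are finite because level plus dimension of the type (II) cell drops along antecedents
(`face_cases`, `rank_lt`). -/

namespace SimplexCategory

/-! ### Order-preserving maps between finite ordinals -/

lemma coe_δ_apply {n : ℕ} (i : Fin (n + 2)) (a : Fin (n + 1)) :
    ((δ i a : Fin (n + 2)) : ℕ) = if (a : ℕ) < i then (a : ℕ) else a + 1 := by
  change ((Fin.succAbove i a : Fin (n + 2)) : ℕ) = _
  simp only [Fin.succAbove, Fin.lt_def, Fin.val_castSucc]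
  split_ifs <;> simp

lemma coe_σ_apply {n : ℕ} (i : Fin (n + 1)) (a : Fin (n + 2)) :
    ((σ i a : Fin (n + 1)) : ℕ) = if (a : ℕ) ≤ i then (a : ℕ) else a - 1 := by
  change ((Fin.predAbove i a : Fin (n + 1)) : ℕ) = _
  simp only [Fin.predAbove, Fin.lt_def, Fin.val_castSucc]
  split_ifs <;> first | omega | simp

lemma coe_comp_apply {l m n : ℕ} (φ : ⦋l⦌ ⟶ ⦋m⦌) (θ : ⦋m⦌ ⟶ ⦋n⦌) (a : Fin (l + 1)) :
    ((φ ≫ θ) a : Fin (n + 1)) = θ (φ a) := rfl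

lemma coe_id_apply {n : ℕ} (a : Fin (n + 1)) : ((𝟙 ⦋n⦌ : ⦋n⦌ ⟶ ⦋n⦌) a : Fin (n + 1)) = a := rfl

lemma hom_ext_val {m n : ℕ} {φ θ : ⦋m⦌ ⟶ ⦋n⦌}
    (h : ∀ a : Fin (m + 1), ((φ a : Fin (n + 1)) : ℕ) = (θ a : Fin (n + 1))) : φ = θ := by
  ext a
  exact h a

lemma le_apply_of_mono {m n : ℕ} (φ : ⦋m⦌ ⟶ ⦋n⦌) [Mono φ] (a : Fin (m + 1)) :
    (a : ℕ) ≤ (φ a : Fin (n + 1)) := by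
  have h : StrictMono φ.toOrderHom :=
    φ.toOrderHom.monotone.strictMono_of_injective (mono_iff_injective.1 ‹_›)
  obtain ⟨a, ha⟩ := a
  induction a with
  | zero => exact Nat.zero_le _
  | succ a ih =>
    have h₂ : φ.toOrderHom ⟨a, Nat.lt_of_succ_lt ha⟩ < φ.toOrderHom ⟨a + 1, ha⟩ := h (by simp [Fin.lt_def])
    exact Nat.succ_le_of_lt (lt_of_le_of_lt (ih (Nat.lt_of_succ_lt ha)) (Fin.lt_def.1 h₂))

lemma apply_lt_apply_of_mono {m n : ℕ} (φ : ⦋m⦌ ⟶ ⦋n⦌) [Mono φ] {a b : Fin (m + 1)} (h : a < b) :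
    (φ a : Fin (n + 1)) < φ b :=
  φ.toOrderHom.monotone.strictMono_of_injective (mono_iff_injective.1 ‹_›) h

/-- A strictly increasing map never falls below the identity, so meeting it at `a` leaves no room
for gaps before `a`. -/
lemma apply_eq_of_le_of_mono {m n : ℕ} (φ : ⦋m⦌ ⟶ ⦋n⦌) [Mono φ] (a : Fin (m + 1))
    (ha : ((φ a : Fin (n + 1)) : ℕ) ≤ a) (b : Fin (m + 1)) (hb : b ≤ a) :
    ((φ b : Fin (n + 1)) : ℕ) = b := by
  induction a using Fin.induction with
  | zero =>
    obtain rfl := Fin.le_zero_iff.1 hb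
    exact le_antisymm ha (le_apply_of_mono φ _)
  | succ a ih =>
    obtain rfl | hb := hb.eq_or_lt
    · exact le_antisymm ha (le_apply_of_mono φ _)
    · refine ih ?_ (Fin.le_castSucc_iff.2 hb)
      have := Fin.lt_def.1 (apply_lt_apply_of_mono φ a.castSucc_lt_succ)
      rw [Fin.val_succ] at ha
      rw [Fin.val_castSucc]
      omega

/-- The preimage of an initial segment is an initial segment; its length `c` is the cutoff of the
operator obtained by restricting a truncated cell along `φ`. -/
lemma exists_lt_iff_apply_lt {m n : ℕ} (φ : ⦋m⦌ ⟶ ⦋n⦌) (k : ℕ) :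
    ∃ c, c ≤ m + 1 ∧ ∀ a : Fin (m + 1), (a : ℕ) < c ↔ ((φ a : Fin (n + 1)) : ℕ) < k := by
  classical
  by_cases h : ∃ c, ∃ hc : c < m + 1, k ≤ ((φ (⟨c, hc⟩ : Fin (m + 1)) : Fin (n + 1)) : ℕ)
  · obtain ⟨hc, hk⟩ := Nat.find_spec h
    refine ⟨Nat.find h, hc.le, fun a ↦ ⟨fun ha ↦ ?_, fun ha ↦ ?_⟩⟩
    · by_contra! ha'
      exact Nat.find_min h ha ⟨a.2, ha'⟩
    · by_contra! ha'
      have : (φ (⟨Nat.find h, hc⟩ : Fin (m + 1)) : Fin (n + 1)) ≤ φ a :=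
        φ.toOrderHom.monotone (by simpa [Fin.le_def] using ha')
      rw [Fin.le_def] at this
      exact absurd (hk.trans this) (by omega)
  · push Not at h
    exact ⟨m + 1, le_rfl, fun a ↦ ⟨fun _ ↦ h a a.2, fun _ ↦ a.2⟩⟩

end SimplexCategory

/-! ### Abstract operators and truncations -/

namespace SSet

open SimplexCategory

/-- Operators on the cells of a simplicial set `Z`, indexed by pairs consisting of a morphism
`θ : ⦋m⦌ ⟶ ⦋n⦌` and a natural number `k`. Such a pair stands for the order-preserving map
`K([m]) → K([n])` which sends `S` to `θ(S)` if `max S < k`, and to `{0, …, θ(max S)}` otherwise;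
the law `op_op` says when the composite of two such maps is again of this form. -/
structure MaxAction (Z : SSet.{u}) where
  /-- the operator attached to `θ` and `k` -/
  op {m n : ℕ} (θ : ⦋m⦌ ⟶ ⦋n⦌) (k : ℕ) (z : Z _⦋n⦌) : Z _⦋m⦌
  op_of_lt {m n : ℕ} (θ : ⦋m⦌ ⟶ ⦋n⦌) (k : ℕ) (z : Z _⦋n⦌) (h : m < k) : op θ k z = Z.map θ.op z
  op_op {l m n : ℕ} (φ : ⦋l⦌ ⟶ ⦋m⦌) (θ : ⦋m⦌ ⟶ ⦋n⦌) (p k c : ℕ) (z : Z _⦋n⦌)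
    (h : ∀ a : Fin (l + 1), (a : ℕ) < c ↔ (a : ℕ) < p ∧ ((φ a : Fin (m + 1)) : ℕ) < k)
    (h' : ∀ a : Fin (l + 1), p ≤ (a : ℕ) → ((φ a : Fin (m + 1)) : ℕ) < k →
      ∀ b : Fin (n + 1), (b : ℕ) ≤ (θ (φ a) : Fin (n + 1)) →
        ∃ x : Fin (m + 1), (θ x : Fin (n + 1)) = b) :
    op φ p (op θ k z) = op (φ ≫ θ) c z

namespace MaxAction

variable {Z : SSet.{u}} (T : MaxAction Z)

lemma op_congr {m n : ℕ} {θ θ' : ⦋m⦌ ⟶ ⦋n⦌} (k : ℕ) (z : Z _⦋n⦌)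
    (h : ∀ a : Fin (m + 1), ((θ a : Fin (n + 1)) : ℕ) = (θ' a : Fin (n + 1))) :
    T.op θ k z = T.op θ' k z := by
  rw [hom_ext_val h]

/-- An ordinary restriction is an operator with cutoff beyond every vertex, which makes the
surjectivity condition of `op_op` vacuous. -/
lemma map_op {l m n : ℕ} (φ : ⦋l⦌ ⟶ ⦋m⦌) (θ : ⦋m⦌ ⟶ ⦋n⦌) (k c : ℕ) (z : Z _⦋n⦌)
    (h : ∀ a : Fin (l + 1), (a : ℕ) < c ↔ ((φ a : Fin (m + 1)) : ℕ) < k) :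
    Z.map φ.op (T.op θ k z) = T.op (φ ≫ θ) c z := by
  rw [← T.op_of_lt φ (l + 1) _ (Nat.lt_succ_self l)]
  refine T.op_op _ _ _ _ _ _ (fun a ↦ ?_) (fun a ha ↦ ?_)
  · rw [h, and_iff_right a.2]
  · exact absurd a.2 (by omega)

/-- The idempotent operator given by `S ↦ S` if `max S < k`, `S ↦ {0, …, max S}` otherwise. -/
def trunc (k : ℕ) {n : ℕ} (z : Z _⦋n⦌) : Z _⦋n⦌ := T.op (𝟙 _) k z

/-- The operator given by `S ↦ S` if `max S ≤ i`, `S ↦ {0, …, max S - 1}` otherwise. -/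
def cone {n : ℕ} (i : Fin (n + 1)) (z : Z _⦋n⦌) : Z _⦋n + 1⦌ :=
  T.op (σ i) (i + 1) z

lemma trunc_trunc (k l : ℕ) {n : ℕ} (z : Z _⦋n⦌) :
    T.trunc l (T.trunc k z) = T.trunc (min l k) z := by
  refine (T.op_op _ _ _ _ (min l k) _ (fun a ↦ ?_) (fun a _ _ b _ ↦ ⟨b, rfl⟩)).trans
    (T.op_congr _ _ fun a ↦ rfl)
  rw [coe_id_apply, lt_min_iff]

lemma trunc_of_le {k l n : ℕ} {z : Z _⦋n⦌} (hz : T.trunc k z = z) (h : k ≤ l) :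
    T.trunc l z = z := by
  have := T.trunc_trunc k l z
  rwa [hz, min_eq_right h, hz] at this

lemma trunc_of_lt {k n : ℕ} (z : Z _⦋n⦌) (h : n < k) : T.trunc k z = z := by
  rw [trunc, T.op_of_lt _ _ _ h]
  simp

lemma map_of_trunc {m n k c : ℕ} {z : Z _⦋n⦌} (hz : T.trunc k z = z) (φ : ⦋m⦌ ⟶ ⦋n⦌)
    (h : ∀ a : Fin (m + 1), (a : ℕ) < c ↔ ((φ a : Fin (n + 1)) : ℕ) < k) :
    Z.map φ.op z = T.op φ c z := by
  nth_rw 1 [← hz]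
  exact (T.map_op φ _ _ _ _ h).trans (T.op_congr _ _ fun a ↦ rfl)

lemma trunc_op {m n : ℕ} (φ : ⦋m⦌ ⟶ ⦋n⦌) (k l : ℕ) (z : Z _⦋n⦌)
    (hφ : ∀ a : Fin (m + 1), k ≤ (a : ℕ) → (a : ℕ) < l → ∀ b : Fin (n + 1),
      (b : ℕ) ≤ (φ a : Fin (n + 1)) → ∃ x : Fin (m + 1), (φ x : Fin (n + 1)) = b) :
    T.trunc k (T.op φ l z) = T.op φ (min k l) z :=
  (T.op_op _ _ _ _ (min k l) _ (fun a ↦ by rw [coe_id_apply, lt_min_iff]) hφ).trans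
    (T.op_congr _ _ fun a ↦ rfl)

lemma trunc_op_of_le {m n : ℕ} (φ : ⦋m⦌ ⟶ ⦋n⦌) {k l : ℕ} (z : Z _⦋n⦌) (h : l ≤ k) :
    T.trunc k (T.op φ l z) = T.op φ l z := by
  rw [T.trunc_op, min_eq_right h]
  intro a h₁ h₂
  omega

lemma trunc_map {m n k l : ℕ} {z : Z _⦋n⦌} (hz : T.trunc k z = z) (φ : ⦋m⦌ ⟶ ⦋n⦌)
    (h : ∀ a : Fin (m + 1), ((φ a : Fin (n + 1)) : ℕ) < k → (a : ℕ) < l) :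
    T.trunc l (Z.map φ.op z) = Z.map φ.op z := by
  obtain ⟨c, hc, hc'⟩ := exists_lt_iff_apply_lt φ k
  rw [T.map_of_trunc hz φ hc']
  refine T.trunc_op_of_le _ _ ?_
  by_contra! h₁
  exact absurd (h ⟨l, by omega⟩ ((hc' ⟨l, by omega⟩).1 h₁)) (by simp)

lemma trunc_map_of_mono {m n k : ℕ} {z : Z _⦋n⦌} (hz : T.trunc k z = z) (φ : ⦋m⦌ ⟶ ⦋n⦌) [Mono φ] :
    T.trunc k (Z.map φ.op z) = Z.map φ.op z :=
  T.trunc_map hz φ fun a ha ↦ (le_apply_of_mono φ a).trans_lt ha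

/-! ### Cones: faces, degeneracies and truncations -/

lemma surj_σ {n : ℕ} (i : Fin (n + 1)) (b : Fin (n + 1)) :
    ∃ x : Fin (n + 2), (σ i x : Fin (n + 1)) = b := by
  by_cases h : (b : ℕ) ≤ i
  · refine ⟨⟨b, by omega⟩, Fin.ext ?_⟩
    rw [coe_σ_apply]
    simp [h]
  · refine ⟨⟨b + 1, by omega⟩, Fin.ext ?_⟩
    rw [coe_σ_apply]
    simp
    omega

lemma δ_cone {n : ℕ} (i : Fin (n + 1)) (z : Z _⦋n⦌) :
    Z.δ i.succ (T.cone i z) = T.trunc (i + 1) z := by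
  refine (T.map_op _ _ _ (i + 1) _ fun a ↦ ?_).trans (T.op_congr _ _ fun a ↦ ?_)
  · rw [coe_δ_apply, Fin.val_succ]
    split_ifs <;> omega
  · rw [coe_comp_apply, coe_σ_apply, coe_δ_apply, coe_id_apply, Fin.val_succ]
    split_ifs <;> omega

lemma trunc_cone {n : ℕ} (i : Fin (n + 1)) (z : Z _⦋n⦌) :
    T.trunc (i + 1) (T.cone i z) = T.cone i z :=
  T.trunc_op_of_le _ _ le_rfl

lemma cone_trunc {n : ℕ} (i : Fin (n + 1)) (z : Z _⦋n⦌) :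
    T.cone i (T.trunc (i + 1) z) = T.cone i z := by
  refine (T.op_op _ _ _ _ (i + 1) _ (fun a ↦ ?_) (fun a _ _ b _ ↦ ⟨b, rfl⟩)).trans
    (T.op_congr _ _ fun a ↦ rfl)
  rw [coe_σ_apply]
  split_ifs <;> omega

lemma trunc_cone_eq_cone_trunc {n : ℕ} (i : Fin (n + 1)) (z : Z _⦋n⦌) :
    T.trunc i (T.cone i z) = T.cone i (T.trunc i z) := by
  have h₁ : T.trunc i (T.cone i z) = T.op (σ i) i z := by
    rw [cone, T.trunc_op _ _ _ _ (fun a _ _ b _ ↦ surj_σ i b), min_eq_left (by omega)]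
  have h₂ : T.cone i (T.trunc i z) = T.op (σ i) i z := by
    refine (T.op_op _ _ _ _ i _ (fun a ↦ ?_) (fun a _ _ b _ ↦ ⟨b, rfl⟩)).trans
      (T.op_congr _ _ fun a ↦ rfl)
    rw [coe_σ_apply]
    split_ifs <;> omega
  rw [h₁, h₂]

lemma trunc_cone_eq_self_iff {n : ℕ} (i : Fin (n + 1)) {z : Z _⦋n⦌} (hz : T.trunc (i + 1) z = z) :
    T.trunc i (T.cone i z) = T.cone i z ↔ T.trunc i z = z := by
  refine ⟨fun h ↦ ?_, fun h ↦ by rw [T.trunc_cone_eq_cone_trunc, h]⟩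
  -- Being fixed by a truncation passes to faces, and face `i + 1` of the cone recovers `z`.
  have h' := T.trunc_map_of_mono h (δ i.succ)
  change T.trunc i (Z.δ i.succ (T.cone i z)) = Z.δ i.succ (T.cone i z) at h'
  rwa [T.δ_cone, hz] at h'

/-- Faces of `T.cone i z` which avoid a vertex `j ≤ i`. -/
lemma trunc_map_cone {m n : ℕ} (i : Fin (n + 1)) (z : Z _⦋n⦌) (φ : ⦋m⦌ ⟶ ⦋n + 1⦌) [Mono φ]
    (h : ∀ a : Fin (m + 1), ((φ a : Fin (n + 2)) : ℕ) < i + 1 → (a : ℕ) < i) :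
    T.trunc i (Z.map φ.op (T.cone i z)) = Z.map φ.op (T.cone i z) :=
  T.trunc_map (T.trunc_cone i z) φ h

/-- Faces of `T.cone i z` which contain the vertices `0`, …, `i + 1`. -/
lemma exists_map_cone_eq_cone {m n : ℕ} (i : Fin (n + 1)) {z : Z _⦋n⦌}
    (hz : T.trunc (i + 1) z = z) (φ : ⦋m + 1⦌ ⟶ ⦋n + 1⦌) [Mono φ] (hi : (i : ℕ) < m + 1)
    (h : ∀ a : Fin (m + 2), (a : ℕ) ≤ i + 1 → ((φ a : Fin (n + 2)) : ℕ) = a) :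
    ∃ t : Z _⦋m⦌, Z.map φ.op (T.cone i z) = T.cone ⟨i, hi⟩ t := by
  -- The base of the new cone is its face `i + 1`, seen as a face of `z` by identifying `i + 1` with
  -- `i`.
  let ψ : ⦋m⦌ ⟶ ⦋n⦌ := δ ⟨i + 1, by omega⟩ ≫ φ ≫ σ i
  have hψ (a : Fin (m + 1)) (ha : (a : ℕ) ≤ i) : ((ψ a : Fin (n + 1)) : ℕ) = a := by
    have : (δ ⟨i + 1, by omega⟩ a : Fin (m + 2)) = a.castSucc := by
      ext
      rw [coe_δ_apply]
      simp
      omega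
    rw [coe_comp_apply, coe_comp_apply, coe_σ_apply, this, h _ (by simp; omega)]
    simp
    omega
  have hφ (a : Fin (m + 2)) : (a : ℕ) < i + 1 ↔ ((φ a : Fin (n + 2)) : ℕ) < i + 1 := by
    refine ⟨fun ha ↦ by rwa [h _ ha.le], fun ha ↦ ?_⟩
    have := le_apply_of_mono φ a
    omega
  have hψ' (a : Fin (m + 1)) : (a : ℕ) < i + 1 ↔ ((ψ a : Fin (n + 1)) : ℕ) < i + 1 := by
    refine ⟨fun ha ↦ by rwa [hψ _ (by omega)], fun ha ↦ ?_⟩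
    by_contra! h₁
    rw [coe_comp_apply, coe_comp_apply, coe_σ_apply] at ha
    have h₂ := le_apply_of_mono φ (δ ⟨i + 1, by omega⟩ a)
    rw [coe_δ_apply] at h₂
    simp only at h₂
    split_ifs at ha h₂ <;> omega
  refine ⟨Z.map ψ.op z, ?_⟩
  rw [T.map_of_trunc hz ψ hψ']
  refine (T.map_op _ _ _ (i + 1) _ hφ).trans (Eq.symm ?_)
  refine (T.op_op _ _ _ _ (i + 1) _ (fun a ↦ ?_) (fun a h₁ h₂ b hb ↦ ?_)).trans
    (T.op_congr _ _ fun a ↦ ?_)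
  · rw [coe_σ_apply]
    split_ifs <;> simp_all
  · have h₃ : (b : ℕ) ≤ i := by
      have := (hψ _ (Nat.lt_succ_iff.1 h₂))
      omega
    exact ⟨⟨b, by omega⟩, Fin.ext (hψ _ h₃)⟩
  · change ((σ i (φ (δ ⟨i + 1, by omega⟩ (σ ⟨i, hi⟩ a))) : Fin (n + 1)) : ℕ) =
      (σ i (φ a) : Fin (n + 1))
    -- Only the vertex `i + 1` is moved, to `i`; `φ` fixes both vertices and `σ i` identifies them.
    by_cases ha : (a : ℕ) = i + 1
    · have : (δ ⟨i + 1, by omega⟩ (σ ⟨i, hi⟩ a) : Fin (m + 2)) = ⟨i, Nat.lt_succ_of_lt hi⟩ := by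
        ext
        rw [coe_δ_apply, coe_σ_apply]
        simp [ha]
      rw [this, coe_σ_apply, coe_σ_apply, h _ (by simp), h _ ha.le]
      simp [ha]
    · have : (δ ⟨i + 1, by omega⟩ (σ ⟨i, hi⟩ a) : Fin (m + 2)) = a := by
        ext
        rw [coe_δ_apply, coe_σ_apply]
        simp only
        split_ifs <;> omega
      rw [this]

/-- Both sides come from one operator, by a simplicial identity between degeneracies. This is why a
cone cannot itself be of type (II). -/
lemma cone_cone {n : ℕ} (i : Fin (n + 1)) (t : Z _⦋n⦌) :
    T.cone i.castSucc (T.cone i t) = Z.σ i.succ (T.cone i t) := by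
  have h₁ : T.cone i.castSucc (T.cone i t) = T.op (σ i.castSucc ≫ σ i) (i + 1) t := by
    refine T.op_op _ _ _ _ _ _ (fun a ↦ ?_) (fun a _ _ b _ ↦ surj_σ i b)
    rw [coe_σ_apply]
    simp only [Fin.val_castSucc]
    split_ifs <;> omega
  rw [h₁]
  refine Eq.trans (T.op_congr _ _ fun a ↦ ?_) (T.map_op _ _ _ (i + 1) _ fun a ↦ ?_).symm
  · simp only [coe_comp_apply, coe_σ_apply, Fin.val_castSucc, Fin.val_succ]
    split_ifs <;> omega
  · simp only [coe_σ_apply, Fin.val_succ]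
    split_ifs <;> omega

lemma cone_σ_of_lt {n : ℕ} (i : Fin (n + 2)) (j : Fin (n + 1)) (h : (i : ℕ) < j) (t : Z _⦋n⦌) :
    T.cone i (Z.σ j t) = Z.σ j.succ (T.cone ⟨i, by omega⟩ t) := by
  have h₁ : T.cone i (Z.σ j t) = T.op (σ i ≫ σ j) (i + 1) t := by
    change T.cone i (Z.map (σ j).op t) = _
    rw [← T.op_of_lt (σ j) (n + 2) _ (by omega)]
    exact T.op_op _ _ _ _ _ _ (fun a ↦ ⟨fun ha ↦ ⟨ha, Fin.isLt _⟩, And.left⟩) (fun a _ _ b _ ↦ surj_σ j b)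
  rw [h₁]
  refine Eq.trans (T.op_congr _ _ fun a ↦ ?_) (T.map_op _ _ _ (i + 1) _ fun a ↦ ?_).symm
  · simp only [coe_comp_apply, coe_σ_apply, Fin.val_succ]
    split_ifs <;> omega
  · simp only [coe_σ_apply, Fin.val_succ]
    split_ifs <;> omega

lemma cone_σ_of_gt {n : ℕ} (i : Fin (n + 2)) (j : Fin (n + 1)) (h : (j : ℕ) < i) (t : Z _⦋n⦌) :
    T.cone i (Z.σ j t) = Z.σ j.castSucc (T.op (σ ⟨i - 1, by omega⟩) i t) := by
  have h₁ : T.cone i (Z.σ j t) = T.op (σ i ≫ σ j) (i + 1) t := by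
    change T.cone i (Z.map (σ j).op t) = _
    rw [← T.op_of_lt (σ j) (n + 2) _ (by omega)]
    exact T.op_op _ _ _ _ _ _ (fun a ↦ ⟨fun ha ↦ ⟨ha, Fin.isLt _⟩, And.left⟩) (fun a _ _ b _ ↦ surj_σ j b)
  rw [h₁]
  refine Eq.trans (T.op_congr _ _ fun a ↦ ?_) (T.map_op _ _ _ (i + 1) _ fun a ↦ ?_).symm
  · simp only [coe_comp_apply, coe_σ_apply, Fin.val_castSucc]
    split_ifs <;> omega
  · simp only [coe_σ_apply, Fin.val_castSucc]
    split_ifs <;> omega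

lemma cone_mem_degenerate {n : ℕ} (i : Fin (n + 1)) {t : Z _⦋n⦌} (ht : T.trunc (i + 1) t = t)
    (h : t ∈ Z.degenerate n) : T.cone i t ∈ Z.degenerate (n + 1) := by
  obtain _ | n := n
  · simp at h
  simp only [degenerate_eq_iUnion_range_σ, Set.mem_iUnion, Set.mem_range] at h
  obtain ⟨j, t, rfl⟩ := h
  obtain h | h | h := lt_trichotomy (i : ℕ) j
  · rw [T.cone_σ_of_lt _ _ h]
    exact Z.σ_mem_degenerate _ _
  · obtain rfl : i = j.castSucc := Fin.ext h
    -- Truncating at `j + 1`, which fixes this cell by `ht`, turns the degeneracy into a cone, so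
    -- that `cone_cone` applies.
    have h₁ : Z.σ j t = T.cone j t := by
      rw [← ht]
      change T.trunc _ (Z.map (σ j).op t) = _
      rw [← T.op_of_lt (σ j) (n + 2) _ (by omega),
        T.trunc_op _ _ _ _ (fun a _ _ b _ ↦ surj_σ j b), min_eq_left (by simp)]
      rfl
    rw [h₁, T.cone_cone]
    exact Z.σ_mem_degenerate _ _
  · rw [T.cone_σ_of_gt _ _ h]
    exact Z.σ_mem_degenerate _ _

/-! ### Levels and nondegenerate cones -/

/-- The cell `z` is of the form `T.cone i t`. -/
def IsCone (i : ℕ) {n : ℕ} (z : Z _⦋n⦌) : Prop :=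
  ∃ (m : ℕ) (j : Fin (m + 1)) (t : Z _⦋m⦌), (j : ℕ) = i ∧ S.mk z = S.mk (T.cone j t)

lemma isCone_cone {n : ℕ} (i : Fin (n + 1)) (t : Z _⦋n⦌) : T.IsCone i (T.cone i t) :=
  ⟨n, i, t, rfl, rfl⟩

variable {T} in
lemma IsCone.exists_eq {i n : ℕ} {z : Z _⦋n⦌} (h : T.IsCone i z) :
    ∃ (m : ℕ) (_ : n = m + 1) (hi : i < m + 1) (t : Z _⦋m⦌), T.trunc (i + 1) t = t ∧
      S.mk z = S.mk (T.cone ⟨i, hi⟩ t) := by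
  obtain ⟨m, j, t, rfl, hz⟩ := h
  -- A cone depends only on the truncation of its base, so the base may be taken truncated.
  refine ⟨m, S.dim_eq_of_mk_eq hz, j.2, T.trunc (j + 1) t, ?_, ?_⟩
  · rw [T.trunc_trunc, min_self]
  · rw [T.cone_trunc, hz]

lemma cone_mem_degenerate_of_isCone {n : ℕ} (i : Fin (n + 1)) {z : Z _⦋n⦌} (h : T.IsCone i z) :
    T.cone i z ∈ Z.degenerate (n + 1) := by
  obtain ⟨m, rfl, hi, t, ht, hz⟩ := h.exists_eq
  obtain rfl : z = T.cone ⟨i, hi⟩ t := by simpa using hz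
  exact (T.cone_cone ⟨i, hi⟩ t).symm ▸ Z.σ_mem_degenerate _ _

lemma trunc_δ_cone {n : ℕ} (i : Fin (n + 1)) (z : Z _⦋n⦌) (j : Fin (n + 2)) (h : (j : ℕ) ≤ i) :
    T.trunc i (Z.δ j (T.cone i z)) = Z.δ j (T.cone i z) :=
  T.trunc_map_cone i z (δ j) fun a ↦ by
    rw [coe_δ_apply]
    split_ifs <;> omega

lemma isCone_δ_cone {n : ℕ} (i : Fin (n + 1)) {z : Z _⦋n⦌} (hz : T.trunc (i + 1) z = z)
    (j : Fin (n + 2)) (h : (i : ℕ) + 1 < j) : T.IsCone i (Z.δ j (T.cone i z)) := by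
  obtain _ | n := n
  · omega
  obtain ⟨t, ht⟩ := T.exists_map_cone_eq_cone i hz (δ j) (by omega) (fun a ha ↦ by
    rw [coe_δ_apply]
    split_ifs <;> omega)
  exact ⟨n, _, t, rfl, congrArg S.mk ht⟩

/-- The level of a cell `z` is the greatest `i` such that `T.trunc i z ≠ z`. -/
def HasLevel (i : ℕ) {n : ℕ} (z : Z _⦋n⦌) : Prop := T.trunc i z ≠ z ∧ T.trunc (i + 1) z = z

variable {T} in
lemma HasLevel.lt_of_trunc {i k n : ℕ} {z : Z _⦋n⦌} (h : T.HasLevel i z) (hk : T.trunc k z = z) :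
    i < k := by
  by_contra! h'
  exact h.1 (T.trunc_of_le hk h')

variable {T} in
lemma HasLevel.le {i n : ℕ} {z : Z _⦋n⦌} (h : T.HasLevel i z) : i ≤ n :=
  Nat.lt_succ_iff.1 (h.lt_of_trunc (T.trunc_of_lt z (Nat.lt_succ_self n)))

variable {T} in
lemma HasLevel.unique {i j n : ℕ} {z : Z _⦋n⦌} (h : T.HasLevel i z) (h' : T.HasLevel j z) :
    i = j :=
  le_antisymm (Nat.lt_succ_iff.1 (h.lt_of_trunc h'.2)) (Nat.lt_succ_iff.1 (h'.lt_of_trunc h.2))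

lemma exists_hasLevel {n : ℕ} {z : Z _⦋n⦌} (h : T.trunc 1 z ≠ z) : ∃ i, 0 < i ∧ T.HasLevel i z := by
  classical
  have h' : ∃ k, T.trunc (k + 1) z = z := ⟨n, T.trunc_of_lt z (Nat.lt_succ_self n)⟩
  have h₀ : 0 < Nat.find h' := by
    rw [Nat.find_pos]
    exact h
  refine ⟨Nat.find h', h₀, ?_, Nat.find_spec h'⟩
  have := Nat.find_min h' (m := Nat.find h' - 1) (by omega)
  rwa [Nat.sub_add_cancel h₀] at this

variable {T} in
lemma HasLevel.cone {n : ℕ} {i : Fin (n + 1)} {z : Z _⦋n⦌} (h : T.HasLevel i z) :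
    T.HasLevel i (T.cone i z) :=
  ⟨fun h' ↦ h.1 ((T.trunc_cone_eq_self_iff i h.2).1 h'), T.trunc_cone i z⟩

lemma hasLevel_of_cone {n : ℕ} {i : Fin (n + 1)} {z : Z _⦋n⦌} (hz : T.trunc (i + 1) z = z)
    (h : T.HasLevel i (T.cone i z)) : T.HasLevel i z :=
  ⟨fun h' ↦ h.1 ((T.trunc_cone_eq_self_iff i hz).2 h'), hz⟩

/-- If the cone is `σ_j v`, then `z = d_{i+1} σ_j v`. For `j = i`, `z` is also face `i` of its cone,
so its level is below `i`; for `j = i + 1`, it is also face `i + 2`, hence a cone. For other `j`,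
`z` is pulled back along a non-injective map, hence degenerate. -/
lemma cone_mem_nonDegenerate {n : ℕ} {i : Fin (n + 1)} {z : Z _⦋n⦌} (h : T.HasLevel i z)
    (hz : z ∈ Z.nonDegenerate n) (h' : ¬ T.IsCone i z) :
    T.cone i z ∈ Z.nonDegenerate (n + 1) := by
  rw [mem_nonDegenerate_iff_notMem_degenerate]
  intro hd
  simp only [degenerate_eq_iUnion_range_σ, Set.mem_iUnion, Set.mem_range] at hd
  obtain ⟨j, v, hv⟩ := hd
  have hz' : z = Z.δ i.succ (Z.σ j v) := by rw [hv, T.δ_cone, h.2]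
  by_cases hj : (j : ℕ) = i ∨ (j : ℕ) = i + 1
  · obtain hj | hj := hj
    · obtain rfl := Fin.ext hj
      obtain rfl : z = v := hz'.trans (by simp)
      apply h.1
      have := T.trunc_δ_cone j z j.castSucc (by simp)
      rwa [← hv, δ_comp_σ_self_apply] at this
    · have h₁ : i.succ = j.castSucc := Fin.ext (by simp [hj])
      obtain rfl : z = v := hz'.trans (by rw [h₁]; simp)
      apply h'
      have := T.isCone_δ_cone i h.2 j.succ (by simp [hj])
      rwa [← hv, δ_comp_σ_succ_apply] at this
  · push Not at hj
    have h₁ : Z.map (δ i.succ ≫ σ j).op v = z := by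
      rw [hz', op_comp, Functor.map_comp]
      rfl
    have := SimplexCategory.mono_iff_injective.1 (Z.mono_of_nonDegenerate ⟨z, hz⟩ _ _ h₁)
    obtain hj' | hj' : (j : ℕ) < i ∨ (i : ℕ) + 1 < j := by omega
    · have h₂ := @this (⟨j, by omega⟩ : Fin (n + 1)) (⟨j + 1, by omega⟩ : Fin (n + 1)) (by
        apply Fin.ext
        change ((σ j (δ i.succ _) : Fin (n + 1)) : ℕ) = (σ j (δ i.succ _) : Fin (n + 1))
        simp only [coe_σ_apply, coe_δ_apply, Fin.val_succ]
        split_ifs <;> omega)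
      exact absurd (Fin.val_eq_of_eq h₂) (by simp)
    · have h₂ := @this (⟨j - 1, by omega⟩ : Fin (n + 1)) (⟨j, by omega⟩ : Fin (n + 1)) (by
        apply Fin.ext
        change ((σ j (δ i.succ _) : Fin (n + 1)) : ℕ) = (σ j (δ i.succ _) : Fin (n + 1))
        simp only [coe_σ_apply, coe_δ_apply, Fin.val_succ]
        split_ifs <;> omega)
      exact absurd (Fin.val_eq_of_eq h₂) (by simp; omega)

/-! ### The pairing, and the decrease of the rank -/

/-- The nondegenerate cells of positive level which are not of the form `T.cone i t`,
where `i` is the level. -/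
structure ConeBase where
  /-- the dimension -/
  dim : ℕ
  /-- the cell -/
  cell : Z _⦋dim⦌
  /-- the level -/
  level : Fin (dim + 1)
  level_pos : 0 < (level : ℕ)
  hasLevel : T.HasLevel level cell
  nonDegenerate : cell ∈ Z.nonDegenerate dim
  not_isCone : ¬ T.IsCone level cell

namespace ConeBase

variable {T}

lemma ext_of_cell {x y : T.ConeBase} (h : S.mk x.cell = S.mk y.cell) : x = y := by
  obtain ⟨n, z, i, _, hz, _, _⟩ := x
  obtain ⟨m, w, j, _, hw, _, _⟩ := y
  obtain rfl := S.dim_eq_of_mk_eq h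
  obtain rfl : z = w := by simpa using h
  obtain rfl := Fin.ext (hz.unique hw)
  rfl

lemma δ_cone (x : T.ConeBase) : Z.δ x.level.succ (T.cone x.level x.cell) = x.cell := by
  rw [T.δ_cone, x.hasLevel.2]

lemma cone_nonDegenerate (x : T.ConeBase) :
    T.cone x.level x.cell ∈ Z.nonDegenerate (x.dim + 1) :=
  T.cone_mem_nonDegenerate x.hasLevel x.nonDegenerate x.not_isCone

lemma ext_of_cone {x y : T.ConeBase}
    (h : S.mk (T.cone x.level x.cell) = S.mk (T.cone y.level y.cell)) : x = y := by
  obtain ⟨n, z, i, _, hz, _, _⟩ := x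
  obtain ⟨m, w, j, _, hw, _, _⟩ := y
  obtain rfl : n = m := by simpa using S.dim_eq_of_mk_eq h
  replace h : T.cone i z = T.cone j w := by simpa using h
  obtain rfl : i = j := Fin.ext (hz.cone.unique (by simpa only [h] using hw.cone))
  obtain rfl : z = w := by rw [← hz.2, ← hw.2, ← T.δ_cone, ← T.δ_cone, h]
  rfl

lemma cone_ne_cell (x y : T.ConeBase) :
    S.mk (T.cone x.level x.cell) ≠ S.mk y.cell := by
  obtain ⟨n, z, i, _, hz, _, _⟩ := x
  obtain ⟨m, w, j, _, hw, _, hc⟩ := y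
  intro h
  obtain rfl : n + 1 = m := S.dim_eq_of_mk_eq h
  obtain rfl : T.cone i z = w := by simpa using h
  have : (i : ℕ) = j := hz.cone.unique hw
  exact hc (this ▸ T.isCone_cone i z)

lemma trunc_one_ne {n : ℕ} {z : Z _⦋n⦌} {i : ℕ} (hi : 0 < i) (h : T.HasLevel i z) :
    T.trunc 1 z ≠ z :=
  fun h' ↦ absurd (h.lt_of_trunc h') (by omega)

lemma exists_eq {n : ℕ} {z : Z _⦋n⦌} (hz : T.trunc 1 z ≠ z) (hd : z ∈ Z.nonDegenerate n) :
    ∃ x : T.ConeBase, S.mk z = S.mk (T.cone x.level x.cell) ∨ S.mk z = S.mk x.cell := by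
  obtain ⟨i, hi, hl⟩ := T.exists_hasLevel hz
  by_cases hc : T.IsCone i z
  · obtain ⟨m, rfl, hi', t, ht, h⟩ := hc.exists_eq
    obtain rfl : z = T.cone ⟨i, hi'⟩ t := by simpa using h
    refine ⟨⟨m, t, ⟨i, hi'⟩, hi, T.hasLevel_of_cone (i := ⟨i, hi'⟩) ht hl, fun h' ↦ ?_,
      fun h' ↦ ?_⟩, Or.inl rfl⟩
    · exact hd (T.cone_mem_degenerate _ ht h')
    · exact hd (T.cone_mem_degenerate_of_isCone _ h')
  · exact ⟨⟨n, z, ⟨i, Nat.lt_succ_iff.2 hl.le⟩, hi, hl, hd, hc⟩, Or.inr rfl⟩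

/-- A natural number attached to a type (II) cell, which decreases along antecedents. -/
def rank (x : T.ConeBase) : ℕ := x.level + x.dim

/-- The nondegenerate faces of `T.cone x.level x.cell` which avoid a vertex `j ≠ x.level + 1`. -/
lemma face_cases (x : T.ConeBase) {m : ℕ} (φ : ⦋m⦌ ⟶ ⦋x.dim + 1⦌) [Mono φ] (j : Fin (x.dim + 2))
    (hj : j ≠ x.level.succ) (hφ : ∀ a : Fin (m + 1), (φ a : Fin (x.dim + 2)) ≠ j) :
    m ≤ x.dim ∧
    (T.trunc x.level (Z.map φ.op (T.cone x.level x.cell)) =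
        Z.map φ.op (T.cone x.level x.cell) ∨
      (T.trunc (x.level + 1) (Z.map φ.op (T.cone x.level x.cell)) =
        Z.map φ.op (T.cone x.level x.cell) ∧
        (m < x.dim ∨ T.IsCone x.level (Z.map φ.op (T.cone x.level x.cell))))) := by
  obtain ⟨n, z, i, hi, hz, hd, hc⟩ := x
  dsimp only at φ j hj hφ ⊢
  have hm : m ≤ n := by
    have h₁ : m ≤ n + 1 := SimplexCategory.len_le_of_mono φ
    by_contra! h₂
    obtain rfl : m = n + 1 := by omega
    obtain rfl := SimplexCategory.eq_id_of_mono φ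
    exact hφ j rfl
  refine ⟨hm, ?_⟩
  -- This holds when the face misses some vertex `≤ i`, and then the level drops. Otherwise `φ` is
  -- the identity on `0, …, i`, which forces `j > i + 1`.
  by_cases h₁ : ∀ a : Fin (m + 1), ((φ a : Fin (n + 2)) : ℕ) < i + 1 → (a : ℕ) < i
  · exact Or.inl (T.trunc_map_cone i z φ h₁)
  refine Or.inr ⟨T.trunc_map_of_mono (T.trunc_cone i z) φ, ?_⟩
  push Not at h₁
  obtain ⟨a, ha, hia⟩ := h₁
  have ha' := le_apply_of_mono φ a
  have hφ' := apply_eq_of_le_of_mono φ a (by omega)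
  have hj' : (i : ℕ) + 1 < j := by
    by_contra! h₂
    have h₃ : (j : ℕ) ≠ i.succ := fun h ↦ hj (Fin.ext h)
    rw [Fin.val_succ] at h₃
    exact hφ ⟨j, by omega⟩ (Fin.ext (hφ' _ (Fin.le_def.2 (by simp only; omega))))
  -- A face containing `i + 1` is again a cone; one missing both `i + 1` and `j` has dimension less
  -- than `n`.
  by_cases h₁ : ∃ b : Fin (m + 1), ((φ b : Fin (n + 2)) : ℕ) = i + 1
  · right
    obtain ⟨b, hb⟩ := h₁
    have hab : a < b := by
      by_contra! h₂
      have := Fin.le_def.1 (φ.toOrderHom.monotone h₂)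
      change ((φ b : Fin (n + 2)) : ℕ) ≤ (φ a : Fin (n + 2)) at this
      omega
    have hφ' := apply_eq_of_le_of_mono φ b (by omega)
    obtain _ | m := m
    · omega
    obtain ⟨t, ht⟩ := T.exists_map_cone_eq_cone i hz.2 φ (by omega) (fun c hc ↦
      hφ' c (Fin.le_def.2 (by omega)))
    exact ⟨m, _, t, rfl, congrArg S.mk ht⟩
  · left
    by_contra! h₂
    obtain rfl : m = n := le_antisymm hm h₂
    obtain ⟨l, rfl⟩ := SimplexCategory.eq_δ_of_mono φ
    have h₃ (k : Fin (m + 2)) (hk : k ≠ l) : ∃ b : Fin (m + 1), (δ l b : Fin (m + 2)) = k :=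
      Fin.exists_succAbove_eq hk
    obtain rfl : j = l := by
      by_contra! h
      obtain ⟨b, hb⟩ := h₃ j h
      exact hφ b hb
    obtain ⟨b, hb⟩ := h₃ i.succ hj.symm
    exact h₁ ⟨b, by rw [hb, Fin.val_succ]⟩

/-- The level never rises. A type (I) face has dimension at most `x.dim`, so its partner is smaller.
A type (II) face of full dimension `x.dim` cannot keep the level of `x`, since by `face_cases` it
would then be a cone at its own level. -/
lemma rank_lt (x y : T.ConeBase) {m : ℕ} (φ : ⦋m⦌ ⟶ ⦋x.dim + 1⦌) [Mono φ] (j : Fin (x.dim + 2))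
    (hj : j ≠ x.level.succ) (hφ : ∀ a : Fin (m + 1), (φ a : Fin (x.dim + 2)) ≠ j)
    (hy : S.mk (Z.map φ.op (T.cone x.level x.cell)) = S.mk y.cell ∨
      S.mk (Z.map φ.op (T.cone x.level x.cell)) = S.mk (T.cone y.level y.cell)) :
    y.rank < x.rank := by
  have h := x.face_cases φ j hj hφ
  generalize Z.map φ.op (T.cone x.level x.cell) = c at h hy
  dsimp only [rank]
  obtain ⟨n, z, i, hi, hz, hd, hc⟩ := x
  obtain ⟨n', z', i', hi', hz', hd', hc'⟩ := y
  dsimp only at h hy ⊢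
  obtain hy | hy := hy
  · obtain rfl : m = n' := S.dim_eq_of_mk_eq hy
    obtain rfl : c = z' := by simpa using hy
    obtain ⟨hm, h | ⟨h, h' | h'⟩⟩ := h
    · have := hz'.lt_of_trunc h
      omega
    · have := hz'.lt_of_trunc h
      omega
    · have h₁ := hz'.lt_of_trunc h
      have h₂ : (i : ℕ) ≠ i' := fun h₂ ↦ hc' (h₂ ▸ h')
      omega
  · obtain rfl : m = n' + 1 := S.dim_eq_of_mk_eq hy
    obtain rfl : c = T.cone i' z' := by simpa using hy
    obtain ⟨hm, h | ⟨h, -⟩⟩ := h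
    · have := hz'.cone.lt_of_trunc h
      omega
    · have := hz'.cone.lt_of_trunc h
      omega

/-- Faces `j ≤ i` have lower level and faces `j > i + 1` are cones; a type (II) cell of level `i` is
neither. -/
lemma eq_of_δ_cone_eq (x : T.ConeBase) (j : Fin (x.dim + 2))
    (hj : Z.δ j (T.cone x.level x.cell) = x.cell) : j = x.level.succ := by
  by_contra! hne
  obtain h | h : (j : ℕ) ≤ x.level ∨ (x.level : ℕ) + 1 < j := by
    have : (j : ℕ) ≠ x.level.succ := fun h ↦ hne (Fin.ext h)
    rw [Fin.val_succ] at this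
    omega
  · have := T.trunc_δ_cone x.level x.cell j h
    rw [hj] at this
    exact x.hasLevel.1 this
  · have := T.isCone_δ_cone x.level x.hasLevel.2 j h
    rw [hj] at this
    exact x.not_isCone this

end ConeBase

variable {A : Z.Subcomplex}
  (hA : ∀ (n : ℕ) (z : Z _⦋n⦌), z ∈ A.obj (Opposite.op ⦋n⦌) ↔ T.trunc 1 z = z)

/-- The pairing attached to `T`. -/
def pairingCore : A.PairingCore where
  ι := T.ConeBase
  dim x := x.dim
  simplex x := T.cone x.level x.cell
  index x := x.level.succ
  nonDegenerate₁ x := x.cone_nonDegenerate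
  nonDegenerate₂ x := by rw [x.δ_cone]; exact x.nonDegenerate
  notMem₁ x := by
    rw [hA]
    exact ConeBase.trunc_one_ne x.level_pos x.hasLevel.cone
  notMem₂ x := by
    rw [hA, x.δ_cone]
    exact ConeBase.trunc_one_ne x.level_pos x.hasLevel
  injective_type₁' h := ConeBase.ext_of_cone h
  injective_type₂' h := by
    rw [ConeBase.δ_cone, ConeBase.δ_cone] at h
    exact ConeBase.ext_of_cell h
  type₁_ne_type₂' x y := by
    rw [y.δ_cone]
    exact ConeBase.cone_ne_cell x y
  surjective' x := by
    obtain ⟨y, hy⟩ := ConeBase.exists_eq (T := T) (mt (hA _ _).2 x.notMem) x.nonDegenerate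
    refine ⟨y, ?_⟩
    rwa [y.δ_cone]

instance : (T.pairingCore hA).IsProper where
  isUniquelyCodimOneFace x := by
    refine (S.IsUniquelyCodimOneFace.iff _ _).2 ⟨x.level.succ, rfl, fun j hj ↦ ?_⟩
    exact x.eq_of_δ_cone_eq j (hj.trans x.δ_cone)

end MaxAction

/-! ### Finite height from a rank function -/

/-- Antecedents may be degenerate; their nondegenerate roots are still faces, so the rank estimate
applies to them. -/
lemma S.exists_mono_map_eq_toN {B : SSet.{u}} (c : B.S) :
    ∃ s : ⦋c.toN.dim⦌ ⟶ ⦋c.dim⦌, Mono s ∧ B.map s.op c.simplex = c.toN.simplex := by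
  obtain ⟨s, hs⟩ := S.le_iff.1 (show c.toN.toS ≤ c from c.subcomplex_toN.le)
  exact ⟨s, B.mono_of_nonDegenerate ⟨_, c.toN.nonDegenerate⟩ s c.simplex hs, hs⟩

namespace Subcomplex.PairingCore

variable {B : SSet.{u}} {A : B.Subcomplex} (h : A.PairingCore) [h.IsProper]

lemma exists_of_mem_ant₀ (x : h.ι) {c : B.S} (hc : c ∈ h.pairing.ant₀ (h.equivII x)) :
    ∃ j : Fin (h.dim x + 2), j ≠ h.index x ∧ c = S.mk (B.δ j (h.simplex x)) := by
  obtain ⟨j, hj, rfl⟩ := hc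
  have key (q : A.N) (hq : q = h.type₁ x) (hd : q.dim = h.dim x + 1) :
      (q.cast hd).simplex = h.simplex x := by
    subst hq
    rfl
  have hs := key _ (h.type₁_pairing x).symm (h.pairing.dim_p (h.equivII x))
  refine ⟨j, fun hj' ↦ hj ?_, ?_⟩
  · rw [← S.IsUniquelyCodimOneFace.δ_eq_iff]
    exact (congrArg (B.δ j) hs).trans (by rw [hj']; rfl)
  · exact congrArg (fun s ↦ S.mk (B.δ j s)) hs

lemma exists_of_mem_ant {b c : B.S} (hc : c ∈ h.pairing.ant b) :
    ∃ x : h.ι, (b.toN = (h.type₂ x).toN ∨ b.toN = (h.type₁ x).toN) ∧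
      ∃ j : Fin (h.dim x + 2), j ≠ h.index x ∧
        ∃ (m : ℕ) (g : ⦋m⦌ ⟶ ⦋h.dim x⦌), Mono g ∧ c = S.mk (B.map (g ≫ δ j).op (h.simplex x)) := by
  obtain ⟨y, hy, a, ha, m, g, hg, rfl⟩ := hc
  obtain ⟨x, rfl⟩ := h.equivII.surjective y
  obtain ⟨j, hj, rfl⟩ := h.exists_of_mem_ant₀ x ha
  refine ⟨x, ?_, j, hj, m, g, hg, ?_⟩
  · rwa [h.type₁_pairing]
  · rw [op_comp, Functor.map_comp]
    rfl

/-- If the nondegenerate faces `d_j (P x)`, `j ≠ i`, all have a smaller rank, then all cells have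
finite height. -/
lemma hasFiniteHeight (rank : h.ι → ℕ)
    (H : ∀ (x y : h.ι) {m : ℕ} (φ : ⦋m⦌ ⟶ ⦋h.dim x + 1⦌) (j : Fin (h.dim x + 2)), Mono φ →
      j ≠ h.index x → (∀ a : Fin (m + 1), (φ a : Fin (h.dim x + 2)) ≠ j) →
      (S.mk (B.map φ.op (h.simplex x)) = (h.type₂ y).toS ∨
        S.mk (B.map φ.op (h.simplex x)) = (h.type₁ y).toS) → rank y < rank x) (b : B.S) :
    h.pairing.HasFiniteHeight b := by
  have key (N : ℕ) (b : B.S) (hb : ∀ x : h.ι, (b.toN = (h.type₂ x).toN ∨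
      b.toN = (h.type₁ x).toN) → rank x < N) : h.pairing.antIter N b = ∅ := by
    induction N generalizing b with
    | zero =>
      refine Set.eq_empty_of_forall_notMem fun c hc ↦ ?_
      obtain ⟨x, hx, -⟩ := h.exists_of_mem_ant hc
      exact absurd (hb x hx) (by simp)
    | succ N ih =>
      simp only [Pairing.antIter, Set.iUnion_eq_empty]
      refine fun c hc ↦ ih c fun y hy ↦ ?_
      obtain ⟨x, hx, j, hj, m, g, hg, rfl⟩ := h.exists_of_mem_ant hc
      refine lt_of_lt_of_le ?_ (Nat.lt_succ_iff.1 (hb x hx))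
      obtain ⟨s, hs, hs'⟩ := S.exists_mono_map_eq_toN
        (S.mk (B.map (g ≫ δ j).op (h.simplex x)))
      refine H x y (s ≫ g ≫ δ j) j inferInstance hj (fun a ↦ Fin.succAbove_ne j _) ?_
      have map_comp {p q r : ℕ} (s : ⦋p⦌ ⟶ ⦋q⦌) (t : ⦋q⦌ ⟶ ⦋r⦌) (z : B _⦋r⦌) :
          B.map (s ≫ t).op z = B.map s.op (B.map t.op z) := by
        rw [op_comp, Functor.map_comp]
        rfl
      rw [(map_comp s _ _).trans hs']
      exact hy.imp (congrArg SSet.N.toS) (congrArg SSet.N.toS)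
  have huniq (x y : h.ι) (hx : b.toN = (h.type₂ x).toN ∨ b.toN = (h.type₁ x).toN)
      (hy : b.toN = (h.type₂ y).toN ∨ b.toN = (h.type₁ y).toN) : x = y := by
    obtain hx | hx := hx <;> obtain hy | hy := hy
    · exact h.injective_type₂ ((N.ext_iff _ _).2 (hx.symm.trans hy))
    · exact (h.type₁_ne_type₂ y x ((N.ext_iff _ _).2 (hy.symm.trans hx))).elim
    · exact (h.type₁_ne_type₂ x y ((N.ext_iff _ _).2 (hx.symm.trans hy))).elim
    · exact h.injective_type₁ ((N.ext_iff _ _).2 (hx.symm.trans hy))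
  by_cases hb : ∃ x : h.ι, b.toN = (h.type₂ x).toN ∨ b.toN = (h.type₁ x).toN
  · obtain ⟨x, hx⟩ := hb
    -- `key` needs a strict bound on the rank of every partner of `b`, and `x` is the only one.
    exact ⟨rank x + 1, key _ _ fun y hy ↦ by rw [huniq x y hx hy]; omega⟩
  · exact ⟨0, key _ _ fun x hx ↦ (hb ⟨x, hx⟩).elim⟩

end Subcomplex.PairingCore

namespace MaxAction

variable {Z : SSet.{u}} (T : MaxAction Z)

lemma hasFiniteHeight_pairingCore {A : Z.Subcomplex}
    (hA : ∀ (n : ℕ) (z : Z _⦋n⦌), z ∈ A.obj (Opposite.op ⦋n⦌) ↔ T.trunc 1 z = z) (b : Z.S) :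
    (T.pairingCore hA).pairing.HasFiniteHeight b := by
  refine (T.pairingCore hA).hasFiniteHeight ConeBase.rank (fun x y m φ j hφ hj h hy ↦ ?_) b
  refine @ConeBase.rank_lt _ T x y m φ hφ j hj h (hy.imp (fun hy ↦ hy.trans ?_) fun hy ↦ hy)
  exact congrArg S.mk y.δ_cone

/-- A map whose image consists of the cells fixed by `T.trunc 1` admits a `P`-structure. -/
noncomputable def pStructure {X : SSet.{u}} (f : X ⟶ Z)
    (hf : ∀ (n : ℕ) (z : Z _⦋n⦌), z ∈ (Subcomplex.range f).obj (Opposite.op ⦋n⦌) ↔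
      T.trunc 1 z = z) :
    PStructure f where
  pairing := (T.pairingCore hf).pairing
  isProper := inferInstance
  finiteHeight _ := T.hasFiniteHeight_pairingCore hf _

end MaxAction

/-! ### Truncation maps on the posets `K([n])` -/

open PartialOrder

lemma le_chainMax {n : ℕ} (S : NonemptyFiniteChains (ULift.{u} (Fin (n + 1))))
    {x : ULift.{u} (Fin (n + 1))} (hx : x ∈ S.finset) : x.down ≤ chainMax ⦋n⦌ S :=
  Finset.le_sup' ULift.down hx

lemma up_chainMax_mem {n : ℕ} (S : NonemptyFiniteChains (ULift.{u} (Fin (n + 1)))) :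
    ULift.up (chainMax ⦋n⦌ S) ∈ S.finset := by
  obtain ⟨x, hx, hx'⟩ := Finset.exists_mem_eq_sup' S.nonempty ULift.down
  have h : chainMax ⦋n⦌ S = x.down := hx'
  rwa [h]

lemma chainMax_eq {n : ℕ} {S : NonemptyFiniteChains (ULift.{u} (Fin (n + 1)))} {a : Fin (n + 1)}
    (h : ULift.up a ∈ S.finset) (h' : ∀ x ∈ S.finset, x.down ≤ a) : chainMax ⦋n⦌ S = a :=
  le_antisymm (h' _ (up_chainMax_mem S)) (le_chainMax S h)

/-- The chain `{0, …, a}`. -/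
def initialChain {n : ℕ} (a : Fin (n + 1)) : NonemptyFiniteChains (ULift.{u} (Fin (n + 1))) where
  finset := Finset.univ.filter fun x ↦ x.down ≤ a
  nonempty := ⟨ULift.up a, by simp⟩
  comparable x y := le_total x.1 y.1

lemma mem_initialChain {n : ℕ} (a : Fin (n + 1)) (x : ULift.{u} (Fin (n + 1))) :
    x ∈ (initialChain a).finset ↔ x.down ≤ a := by
  simp [initialChain]

/-- The order-preserving map `K([m]) → K([n])` which sends `S` to `θ(S)` if `max S < k`,
and to `{0, …, θ(max S)}` otherwise. -/
noncomputable def truncMap {m n : ℕ} (θ : ⦋m⦌ ⟶ ⦋n⦌) (k : ℕ) :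
    NonemptyFiniteChains (ULift.{u} (Fin (m + 1))) →o
      NonemptyFiniteChains (ULift.{u} (Fin (n + 1))) where
  toFun S := if (chainMax ⦋m⦌ S : ℕ) < k then S.map (toPartOrd.{u}.map θ).hom else
    initialChain (θ (chainMax ⦋m⦌ S))
  monotone' S S' h := by
    have h₁ : chainMax ⦋m⦌ S ≤ chainMax ⦋m⦌ S' := (chainMax ⦋m⦌).monotone h
    dsimp only
    split_ifs with h₂ h₃ h₃
    · exact (NonemptyFiniteChains.orderHomMap (toPartOrd.{u}.map θ).hom).monotone h
    · intro y hy
      obtain ⟨x, hx, rfl⟩ := (NonemptyFiniteChains.mem_map_iff _ _ _).1 hy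
      exact (mem_initialChain _ _).2 (θ.toOrderHom.monotone ((le_chainMax S hx).trans h₁))
    · exact absurd (Fin.le_def.1 h₁) (by omega)
    · intro y hy
      rw [mem_initialChain] at hy ⊢
      exact hy.trans (θ.toOrderHom.monotone h₁)

lemma mem_truncMap {m n : ℕ} (θ : ⦋m⦌ ⟶ ⦋n⦌) (k : ℕ)
    (S : NonemptyFiniteChains (ULift.{u} (Fin (m + 1)))) (y : Fin (n + 1)) :
    ULift.up y ∈ (truncMap θ k S).finset ↔
      ((chainMax ⦋m⦌ S : ℕ) < k ∧ ∃ x : Fin (m + 1), ULift.up x ∈ S.finset ∧ θ x = y) ∨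
        (k ≤ (chainMax ⦋m⦌ S : ℕ) ∧ y ≤ θ (chainMax ⦋m⦌ S)) := by
  by_cases h : (chainMax ⦋m⦌ S : ℕ) < k
  · have : truncMap θ k S = S.map (toPartOrd.{u}.map θ).hom := if_pos h
    rw [this]
    refine (NonemptyFiniteChains.mem_map_iff _ _ _).trans ?_
    simp only [h, true_and, not_le.2 h, false_and, or_false]
    constructor
    · rintro ⟨⟨x⟩, hx, hx'⟩
      exact ⟨x, hx, congrArg ULift.down hx'⟩
    · rintro ⟨x, hx, rfl⟩
      exact ⟨⟨x⟩, hx, rfl⟩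
  · have : truncMap θ k S = initialChain (θ (chainMax ⦋m⦌ S)) := if_neg h
    rw [this, mem_initialChain]
    simp [h, not_lt.1 h]

/-- Compatibility with `max` is what makes the operators preserve cells coming from `X` or `Y`. -/
lemma chainMax_truncMap {m n : ℕ} (θ : ⦋m⦌ ⟶ ⦋n⦌) (k : ℕ)
    (S : NonemptyFiniteChains (ULift.{u} (Fin (m + 1)))) :
    chainMax ⦋n⦌ (truncMap θ k S) = θ (chainMax ⦋m⦌ S) := by
  refine chainMax_eq ((mem_truncMap _ _ _ _).2 ?_) fun ⟨x⟩ hx ↦ ?_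
  · obtain h | h := lt_or_ge (chainMax ⦋m⦌ S : ℕ) k
    · exact Or.inl ⟨h, _, up_chainMax_mem S, rfl⟩
    · exact Or.inr ⟨h, le_rfl⟩
  · obtain ⟨-, y, hy, rfl⟩ | ⟨-, h⟩ := (mem_truncMap _ _ _ _).1 hx
    · exact θ.toOrderHom.monotone (le_chainMax S hy)
    · exact h

lemma truncMap_of_lt {m n : ℕ} (θ : ⦋m⦌ ⟶ ⦋n⦌) (k : ℕ) (h : m < k) :
    truncMap.{u} θ k = NonemptyFiniteChains.orderHomMap (toPartOrd.{u}.map θ).hom := by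
  ext1
  funext S
  exact if_pos (lt_of_lt_of_le (Fin.isLt _) h)

lemma truncMap_comp {l m n : ℕ} (φ : ⦋l⦌ ⟶ ⦋m⦌) (θ : ⦋m⦌ ⟶ ⦋n⦌) (p k c : ℕ)
    (h : ∀ a : Fin (l + 1), (a : ℕ) < c ↔ (a : ℕ) < p ∧ ((φ a : Fin (m + 1)) : ℕ) < k)
    (h' : ∀ a : Fin (l + 1), p ≤ (a : ℕ) → ((φ a : Fin (m + 1)) : ℕ) < k →
      ∀ b : Fin (n + 1), (b : ℕ) ≤ (θ (φ a) : Fin (n + 1)) →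
        ∃ x : Fin (m + 1), (θ x : Fin (n + 1)) = b) :
    (truncMap.{u} θ k).comp (truncMap.{u} φ p) = truncMap (φ ≫ θ) c := by
  ext S ⟨y⟩
  change ULift.up y ∈ (truncMap θ k (truncMap φ p S)).finset ↔ _
  rw [mem_truncMap, mem_truncMap, chainMax_truncMap]
  simp only [mem_truncMap]
  have h₁ := h (chainMax ⦋l⦌ S)
  have h₁' := h' (chainMax ⦋l⦌ S)
  have h₂ {x : Fin (l + 1)} (hx : ULift.up x ∈ S.finset) : x ≤ chainMax ⦋l⦌ S := le_chainMax S hx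
  generalize chainMax ⦋l⦌ S = a at *
  have hmono {x y : Fin (l + 1)} (hx : x ≤ y) : (φ x : Fin (m + 1)) ≤ φ y :=
    φ.toOrderHom.monotone hx
  have hmono' {x y : Fin (m + 1)} (hx : x ≤ y) : (θ x : Fin (n + 1)) ≤ θ y :=
    θ.toOrderHom.monotone hx
  change (_ ∨ (k ≤ ((φ a : Fin (m + 1)) : ℕ) ∧ (y : Fin (n + 1)) ≤ θ (φ a))) ↔
    ((a : ℕ) < c ∧ ∃ x : Fin (l + 1), ULift.up x ∈ S.finset ∧ (θ (φ x) : Fin (n + 1)) = y) ∨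
      (c ≤ (a : ℕ) ∧ (y : Fin (n + 1)) ≤ θ (φ a))
  constructor
  · rintro (⟨h₃, x, ⟨h₄, w, hw, rfl⟩ | ⟨h₄, h₅⟩, rfl⟩ | ⟨h₃, h₄⟩)
    · exact Or.inl ⟨h₁.2 ⟨h₄, h₃⟩, w, hw, rfl⟩
    · exact Or.inr ⟨by by_contra! h₆; exact absurd (h₁.1 h₆).1 (by omega), hmono' h₅⟩
    · exact Or.inr ⟨by by_contra! h₆; exact absurd (h₁.1 h₆).2 (by omega), h₄⟩
  · rintro (⟨h₃, x, hx, rfl⟩ | ⟨h₃, h₄⟩)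
    · exact Or.inl ⟨(h₁.1 h₃).2, _, Or.inl ⟨(h₁.1 h₃).1, x, hx, rfl⟩, rfl⟩
    · obtain h₅ | h₅ := lt_or_ge ((φ a : Fin (m + 1)) : ℕ) k
      · have h₆ : p ≤ (a : ℕ) := by
          by_contra! h₆
          have := h₁.2 ⟨h₆, h₅⟩
          omega
        -- The preimage `x` may exceed `φ a`; monotonicity then gives `θ x = θ (φ a)`, and `φ a`
        -- serves instead.
        obtain ⟨x, rfl⟩ := h₁' h₆ h₅ y (Fin.le_def.1 h₄)
        obtain h₇ | h₇ := le_total x (φ a : Fin (m + 1))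
        · exact Or.inl ⟨h₅, x, Or.inr ⟨h₆, h₇⟩, rfl⟩
        · exact Or.inl ⟨h₅, φ a, Or.inr ⟨h₆, le_rfl⟩, le_antisymm (hmono' h₇) h₄⟩
      · exact Or.inr ⟨h₅, h₄⟩

/-- The map `Sd Δ[m] ⟶ Sd Δ[n]` induced by `truncMap θ k`. -/
noncomputable def sdTrunc {m n : ℕ} (θ : ⦋m⦌ ⟶ ⦋n⦌) (k : ℕ) :
    SimplexCategory.sd.{u}.obj ⦋m⦌ ⟶ SimplexCategory.sd.{u}.obj ⦋n⦌ :=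
  PartOrd.nerveFunctor.map (PartOrd.ofHom (truncMap θ k))

lemma sdTrunc_of_lt {m n : ℕ} (θ : ⦋m⦌ ⟶ ⦋n⦌) (k : ℕ) (h : m < k) :
    sdTrunc.{u} θ k = SimplexCategory.sd.{u}.map θ := by
  rw [sdTrunc, truncMap_of_lt θ k h]
  rfl

lemma sdTrunc_comp {l m n : ℕ} (φ : ⦋l⦌ ⟶ ⦋m⦌) (θ : ⦋m⦌ ⟶ ⦋n⦌) (p k c : ℕ)
    (h : ∀ a : Fin (l + 1), (a : ℕ) < c ↔ (a : ℕ) < p ∧ ((φ a : Fin (m + 1)) : ℕ) < k)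
    (h' : ∀ a : Fin (l + 1), p ≤ (a : ℕ) → ((φ a : Fin (m + 1)) : ℕ) < k →
      ∀ b : Fin (n + 1), (b : ℕ) ≤ (θ (φ a) : Fin (n + 1)) →
        ∃ x : Fin (m + 1), (θ x : Fin (n + 1)) = b) :
    sdTrunc.{u} φ p ≫ sdTrunc.{u} θ k = sdTrunc (φ ≫ θ) c := by
  rw [sdTrunc, sdTrunc, sdTrunc, ← truncMap_comp φ θ p k c h h']
  exact (PartOrd.nerveFunctor.map_comp _ _).symm

lemma sdTrunc_sdMax {m n : ℕ} (θ : ⦋m⦌ ⟶ ⦋n⦌) (k : ℕ) :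
    sdTrunc.{u} θ k ≫ sdMax.app ⦋n⦌ = sdMax.app ⦋m⦌ ≫ SSet.stdSimplex.map θ := by
  ext d s
  apply stdSimplex.objEquiv.injective
  ext i
  exact congrArg Fin.val (chainMax_truncMap θ k (s.obj i))

lemma initialChain_mono {n : ℕ} : Monotone (initialChain.{u} (n := n)) := fun a b h x hx ↦ by
  rw [mem_initialChain] at hx ⊢
  exact hx.trans h

/-- The section `a ↦ {0, …, a}` of `Sd Δ[n] ⟶ Δ[n]`. -/
noncomputable def sdMaxSection (n : ℕ) : Δ[n] ⟶ SimplexCategory.sd.{u}.obj ⦋n⦌ where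
  app _ := ↾fun s ↦
    (initialChain_mono.{u}.comp (stdSimplex.objEquiv s).toOrderHom.monotone).functor
  naturality _ _ _ := rfl

lemma sdMaxSection_sdMax (n : ℕ) : sdMaxSection.{u} n ≫ sdMax.app ⦋n⦌ = 𝟙 _ := by
  ext d s
  apply stdSimplex.objEquiv.injective
  ext i
  refine congrArg Fin.val (chainMax_eq ?_ fun x hx ↦ ?_)
  · exact (mem_initialChain _ _).2 le_rfl
  · exact (mem_initialChain _ _).1 hx

/-- Cutoff `1` leaves alone only `S = {0}`, which is already an initial segment. So `trunc 1` is the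
idempotent of the retract `Δ[n]` of `Sd Δ[n]`. -/
lemma initialChain_chainMax {n : ℕ} (S : NonemptyFiniteChains (ULift.{u} (Fin (n + 1)))) :
    initialChain (chainMax ⦋n⦌ S) = truncMap (𝟙 _) 1 S := by
  ext ⟨y⟩
  rw [mem_initialChain, mem_truncMap]
  have h₁ := up_chainMax_mem S
  have h₂ {x : Fin (n + 1)} (hx : ULift.up x ∈ S.finset) : x ≤ chainMax ⦋n⦌ S := le_chainMax S hx
  generalize chainMax ⦋n⦌ S = a at *
  change (y : Fin (n + 1)) ≤ a ↔ ((a : ℕ) < 1 ∧ ∃ x : Fin (n + 1), ULift.up x ∈ S.finset ∧ x = y) ∨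
    (1 ≤ (a : ℕ) ∧ (y : Fin (n + 1)) ≤ a)
  constructor
  · intro h
    obtain h₃ | h₃ := lt_or_ge (a : ℕ) 1
    · exact Or.inl ⟨h₃, a, h₁, Fin.ext (by have := Fin.le_def.1 h; omega)⟩
    · exact Or.inr ⟨h₃, h⟩
  · rintro (⟨-, x, hx, rfl⟩ | ⟨-, h⟩)
    · exact h₂ hx
    · exact h

lemma sdMax_sdMaxSection (n : ℕ) :
    sdMax.app ⦋n⦌ ≫ sdMaxSection.{u} n = sdTrunc (𝟙 _) 1 := by
  ext d s
  exact CategoryTheory.Functor.ext (fun i ↦ initialChain_chainMax (s.obj i)) (fun _ _ _ ↦ Subsingleton.elim _ _)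

/-! ### The action on `Ex X`, with `X` as the fixed cells -/

/-- The action of the maps `sdTrunc` on the cells of `Ex X`. -/
noncomputable def exMaxAction (X : SSet.{u}) : MaxAction (ex.obj X) where
  op θ k s := ULift.up (sdTrunc θ k ≫ s.down)
  op_of_lt θ k s h := by
    rw [sdTrunc_of_lt θ k h]
    rfl
  op_op φ θ p k c z h h' := by
    rw [← sdTrunc_comp φ θ p k c h h', Category.assoc]

lemma exMaxAction_op_map {X Y : SSet.{u}} (f : X ⟶ Y) {m n : ℕ} (θ : ⦋m⦌ ⟶ ⦋n⦌) (k : ℕ)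
    (s : (ex.obj X) _⦋n⦌) :
    (exMaxAction Y).op θ k ((ex.map f).app _ s) = (ex.map f).app _ ((exMaxAction X).op θ k s) :=
  congrArg ULift.up (Category.assoc _ _ _).symm

lemma exMaxAction_op_toEx {X : SSet.{u}} {m n : ℕ} (θ : ⦋m⦌ ⟶ ⦋n⦌) (k : ℕ)
    (x : X _⦋n⦌) :
    (exMaxAction X).op θ k ((toEx.app X).app _ x) = (toEx.app X).app _ (X.map θ.op x) := by
  apply ULift.down_injective
  change sdTrunc θ k ≫ sdMax.app ⦋n⦌ ≫ uliftYonedaEquiv.symm x =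
    sdMax.app ⦋m⦌ ≫ uliftYonedaEquiv.symm (X.map θ.op x)
  rw [uliftYonedaEquiv_symm_map]
  exact (Category.assoc _ _ _).symm.trans
    ((congrArg (· ≫ uliftYonedaEquiv.symm x) (sdTrunc_sdMax θ k)).trans (Category.assoc _ _ _))

lemma toEx_app_injective (X : SSet.{u}) (n : ℕ) :
    Function.Injective ((toEx.app X).app (op ⦋n⦌)) := by
  intro x y h
  have h' : sdMax.app ⦋n⦌ ≫ uliftYonedaEquiv.symm x = sdMax.app ⦋n⦌ ≫ uliftYonedaEquiv.symm y :=
    congrArg ULift.down h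
  apply uliftYonedaEquiv.symm.injective
  have (z : X _⦋n⦌) : uliftYonedaEquiv.symm z =
      sdMaxSection.{u} n ≫ sdMax.app ⦋n⦌ ≫ uliftYonedaEquiv.symm z :=
    ((congrArg (· ≫ uliftYonedaEquiv.symm z) (sdMaxSection_sdMax.{u} n)).trans
      (Category.id_comp _)).symm.trans (Category.assoc _ _ _)
  exact (this x).trans ((congrArg (sdMaxSection.{u} n ≫ ·) h').trans (this y).symm)

/-- A map out of `Sd Δ[n]` factors through the retract `Δ[n]` exactly when the retract's idempotent
fixes it. -/
lemma mem_range_toEx_iff (X : SSet.{u}) (n : ℕ) (s : (ex.obj X) _⦋n⦌) :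
    s ∈ Set.range ((toEx.app X).app (op ⦋n⦌)) ↔ (exMaxAction X).trunc 1 s = s := by
  constructor
  · rintro ⟨x, rfl⟩
    refine (exMaxAction_op_toEx _ _ _).trans ?_
    simp
  · intro h
    refine ⟨uliftYonedaEquiv (sdMaxSection n ≫ s.down), ULift.down_injective ?_⟩
    refine Eq.trans ?_ (congrArg ULift.down h)
    change sdMax.app ⦋n⦌ ≫ uliftYonedaEquiv.symm (uliftYonedaEquiv (sdMaxSection n ≫ s.down)) =
      sdTrunc (𝟙 _) 1 ≫ s.down
    rw [Equiv.symm_apply_apply, ← sdMax_sdMaxSection]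
    exact (Category.assoc _ _ _).symm

/-- Restriction of operators along an injective map whose image they preserve. -/
noncomputable def MaxAction.ofInjective {Z W : SSet.{u}} (T : MaxAction W) (p : Z ⟶ W)
    (hp : ∀ n : ℕ, Function.Injective (p.app (Opposite.op ⦋n⦌)))
    (h : ∀ {m n : ℕ} (θ : ⦋m⦌ ⟶ ⦋n⦌) (k : ℕ) (z : Z _⦋n⦌),
      ∃ w : Z _⦋m⦌, p.app _ w = T.op θ k (p.app _ z)) : MaxAction Z where
  op θ k z := (h θ k z).choose
  op_of_lt {m n} θ k z hk := hp m (by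
    rw [(h θ k z).choose_spec, T.op_of_lt _ _ _ hk]
    exact (NatTrans.naturality_apply p θ.op z).symm)
  op_op φ θ q k c z hc hc' := hp _ (by
    rw [(h _ _ _).choose_spec, (h _ _ _).choose_spec, (h _ _ _).choose_spec]
    exact T.op_op φ θ q k c _ hc hc')

lemma MaxAction.app_op_ofInjective {Z W : SSet.{u}} (T : MaxAction W) (p : Z ⟶ W)
    (hp : ∀ n : ℕ, Function.Injective (p.app (Opposite.op ⦋n⦌)))
    (h : ∀ {m n : ℕ} (θ : ⦋m⦌ ⟶ ⦋n⦌) (k : ℕ) (z : Z _⦋n⦌),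
      ∃ w : Z _⦋m⦌, p.app _ w = T.op θ k (p.app _ z))
    {m n : ℕ} (θ : ⦋m⦌ ⟶ ⦋n⦌) (k : ℕ) (z : Z _⦋n⦌) :
    p.app _ ((T.ofInjective p hp h).op θ k z) = T.op θ k (p.app _ z) :=
  (h θ k z).choose_spec

lemma isCofibration_of_mono {A B : SSet.{u}} (f : A ⟶ B) [Mono f] : isCofibration f := by
  unfold isCofibration
  rw [← rlp_monomorphisms]
  exact MorphismProperty.le_llp_rlp _ _ (MorphismProperty.monomorphisms.infer_property f)

instance mono_toEx_app (X : SSet.{u}) : Mono (toEx.app X) := by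
  rw [NatTrans.mono_iff_mono_app]
  rintro ⟨⟨n⟩⟩
  exact (mono_iff_injective _).2 (toEx_app_injective X n)

/-! ### Transfer to the fibre product -/

section

variable {X Y : SSet.{u}} (f : X ⟶ Y)

lemma toExPullback_fst : toExPullback f ≫ pullback.fst _ _ = toEx.app X :=
  pullback.lift_fst _ _ _

instance : Mono (toExPullback f) := by
  have : Mono (toExPullback f ≫ pullback.fst _ _) := by
    rw [toExPullback_fst]
    infer_instance
  exact mono_of_mono _ (pullback.fst _ _)

lemma pullback_fst_app_injective (n : ℕ) :
    Function.Injective ((pullback.fst (ex.map f) (toEx.app Y)).app (op ⦋n⦌)) :=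
  (mono_iff_injective _).1 inferInstance

/-- This identifies the fibre product with the cells of `Ex X` lying over `Y`. The operators
preserve that condition, as they commute with `ex.map f` and send cells of `Y` to cells of `Y`. -/
lemma mem_range_pullback_fst_iff {n : ℕ} (s : (ex.obj X) _⦋n⦌) :
    (∃ z, (pullback.fst (ex.map f) (toEx.app Y)).app (op ⦋n⦌) z = s) ↔
      ∃ y, (toEx.app Y).app (op ⦋n⦌) y = (ex.map f).app (op ⦋n⦌) s := by
  have sq := (IsPullback.of_hasPullback (ex.map f) (toEx.app Y)).map
    ((evaluation _ _).obj (op ⦋n⦌))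
  constructor
  · rintro ⟨z, rfl⟩
    exact ⟨_, (ConcreteCategory.congr_hom sq.w z).symm⟩
  · rintro ⟨y, hy⟩
    obtain ⟨z, hz, -⟩ := Types.exists_of_isPullback sq s y hy.symm
    exact ⟨z, hz⟩

lemma exists_pullback_fst_eq_op {m n : ℕ} (θ : ⦋m⦌ ⟶ ⦋n⦌) (k : ℕ)
    (z : (pullback (ex.map f) (toEx.app Y)) _⦋n⦌) :
    ∃ w, (pullback.fst (ex.map f) (toEx.app Y)).app (op ⦋m⦌) w =
      (exMaxAction X).op θ k ((pullback.fst (ex.map f) (toEx.app Y)).app (op ⦋n⦌) z) := by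
  obtain ⟨y, hy⟩ := (mem_range_pullback_fst_iff f _).1 ⟨z, rfl⟩
  refine (mem_range_pullback_fst_iff f _).2 ⟨Y.map θ.op y, ?_⟩
  rw [← exMaxAction_op_map, ← hy, exMaxAction_op_toEx]

/-- The action of the maps `sdTrunc` on the cells of `Ex X ×_{Ex Y} Y`. -/
noncomputable def pullbackMaxAction : MaxAction (pullback (ex.map f) (toEx.app Y)) :=
  (exMaxAction X).ofInjective (pullback.fst _ _) (pullback_fst_app_injective f)
    (exists_pullback_fst_eq_op f)

lemma mem_range_toExPullback_iff (n : ℕ) (z : (pullback (ex.map f) (toEx.app Y)) _⦋n⦌) :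
    z ∈ (Subcomplex.range (toExPullback f)).obj (op ⦋n⦌) ↔
      (pullbackMaxAction f).trunc 1 z = z := by
  have h₁ : (pullbackMaxAction f).trunc 1 z = z ↔ (exMaxAction X).trunc 1
      ((pullback.fst (ex.map f) (toEx.app Y)).app _ z) =
        (pullback.fst (ex.map f) (toEx.app Y)).app _ z := by
    rw [← (pullback_fst_app_injective f n).eq_iff]
    exact Eq.congr_left ((exMaxAction X).app_op_ofInjective _ (pullback_fst_app_injective f)
      (exists_pullback_fst_eq_op f) (𝟙 _) 1 z)
  have h₂ (x : X _⦋n⦌) : (pullback.fst (ex.map f) (toEx.app Y)).app _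
      ((toExPullback f).app (op ⦋n⦌) x) = (toEx.app X).app _ x :=
    ConcreteCategory.congr_hom (NatTrans.congr_app (toExPullback_fst f) (op ⦋n⦌)) x
  rw [h₁, ← mem_range_toEx_iff]
  constructor
  · rintro ⟨x, rfl⟩
    exact ⟨x, (h₂ x).symm⟩
  · rintro ⟨x, hx⟩
    exact ⟨x, pullback_fst_app_injective f n ((h₂ x).trans hx)⟩

end

end SSet

theorem mainTheorem6 {X Y : SSet.{u}} (f : X ⟶ Y) (hX : SSet.IsCofibrantSSet X) :
    SSet.IsStronglyAnodyne (SSet.toExPullback f) :=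
  ⟨SSet.isCofibration_of_mono _,
    ⟨(SSet.pullbackMaxAction f).pStructure _ (SSet.mem_range_toExPullback_iff f)⟩⟩
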